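/- Let $p,q,n\ge 1$ be integers and let $z_1,\dots,z_n$ be i.i.d. Gaussian random vectors in $\mathbb{R}^{pq}$ with mean zero and (positive semidefinite) covariance matrix $\Sigma_0$. Let $\hat S_n=\frac1n\sum_{s=1}^n z_sz_s^T$ be the sample covariance matrix. For $A\in\mathbb{R}^{pq\times pq}$ let $A(i,j)\in\mathbb{R}^{q\times q}$, $1\le i,j\le p$, denote its blocks $A(i,j)=[A]_{(i-1)q+1:iq,\,(j-1)q+1:jq}$, and let $\mathcal{R}(A)\in\mathbb{R}^{p^2\times q^2}$ be the matrix whose row number $(i-1)p+j$ is $\mathrm{vec}(A(i,j))^T$, where $\mathrm{vec}$ stacks the columns of a matrix. Set $\Delta_n=\mathcal{R}(\hat S_n-\Sigma_0)$, $M=\max(p,q,n)$, $C_1=\frac{4e}{\sqrt{6\pi}}$, $C_2=e\sqrt2$, $C=\max(C_1,C_2)$, and let $\|\cdot\|_2$ be the spectral norm. Let $0<\epsilon'<\frac12$ and $$t\ \ge\ \max\Big\{\sqrt{4C_1\ln(1+\tfrac{2}{\epsilon'})},\ 4C_2\ln(1+\tfrac{2}{\epsilon'})\Big\}.$$ Then,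 with probability at least $1-2M^{-t/(4C)}$, $$\|\Delta_n\|_2\ \le\ \frac{\|\Sigma_0\|_2\,t}{1-2\epsilon'}\ \max\left\{\frac{p^2+q^2+\log M}{n},\ \sqrt{\frac{p^2+q^2+\log M}{n}}\right\}.$$ -/

import Mathlib

open MeasureTheory ProbabilityTheory
open scoped Matrix Matrix.Norms.L2Operator

namespace PermutedSCM

/-- The sample covariance matrix `(1/n) ∑ₛ zₛ zₛᵀ` of the vectors `z 0, …, z (n-1)`. -/
noncomputable def sampleCov {ι : Type*} {n : ℕ} (z : Fin n → EuclideanSpace ℝ ι) :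
    Matrix ι ι ℝ :=
  (1 / (n : ℝ)) • ∑ s, Matrix.vecMulVec (z s) (z s)

/-- The `q × q` block `M(i,j)` of a `pq × pq` matrix. The index set `{1, …, pq}` is written as
`Fin p × Fin q`, the pair `(i, k)` standing for the position `(i-1)q + k`. -/
def block {p q : ℕ} (M : Matrix (Fin p × Fin q) (Fin p × Fin q) ℝ) (i j : Fin p) :
    Matrix (Fin q) (Fin q) ℝ :=
  Matrix.of fun k l => M (i, k) (j, l)

/-- The permutation operator `R : ℝ^(pq × pq) → ℝ^(p² × q²)`: its row number `(i-1)p + j`,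
written `(i, j)`, is the column-stacking vectorization of the block `M(i,j)`. -/
def rearrange {p q : ℕ} (M : Matrix (Fin p × Fin q) (Fin p × Fin q) ℝ) :
    Matrix (Fin p × Fin p) (Fin q × Fin q) ℝ :=
  Matrix.of fun ij => (block M ij.1 ij.2).vec

/-- The error matrix `Δₙ = R(Ŝₙ - Σ₀)`. -/
noncomputable def errorMatrix {p q n : ℕ} (S₀ : Matrix (Fin p × Fin q) (Fin p × Fin q) ℝ)
    (z : Fin n → EuclideanSpace ℝ (Fin p × Fin q)) :
    Matrix (Fin p × Fin p) (Fin q × Fin q) ℝ :=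
  rearrange (sampleCov z - S₀)

/-- The absolute constant `4e/√(6π)`. -/
noncomputable def C₁ : ℝ := 4 * Real.exp 1 / √(6 * Real.pi)

/-- The absolute constant `e√2`. -/
noncomputable def C₂ : ℝ := Real.exp 1 * √2

end PermutedSCM

/-!
A bilinear form `x ⬝ᵥ Δₙ *ᵥ y` of the rearranged error is an average over the samples of
`zₛ ⬝ᵥ G *ᵥ zₛ - tr (G S₀)`, where `G` is the Kronecker product of the matrices encoded by `x` and
`y`, so that its Frobenius norm is `‖x‖ ‖y‖` (`natCast_mul_dotProduct_errorMatrix_mulVec`,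
`frobSq_coeffMatrix`). Writing `zₛ = √S₀ g` with `g` standard, this is a Gaussian chaos of order
two with matrix `√S₀ G √S₀`, of Frobenius norm at most `‖S₀‖ ‖x‖ ‖y‖`. Its symmetric part can be
diagonalized by a rotation, which preserves the law of `g`; the chaos becomes a weighted sum of
independent centred chi-square variables, and for `‖x‖, ‖y‖ ≤ 1` its moment generating function at
`l` is at most `exp (2 l² ‖S₀‖²)` as long as `|l| ‖S₀‖ ≤ 1 / 4`
(`exp_quadratic_multivariateGaussian`). The Chernoff bound then gives the tail of each bilinear form (`measureReal_lt_dotProduct_errorMatrix_le`).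

The spectral norm is at most `(1 - 2ε')⁻¹` times the maximum of these forms over `ε'`-nets of the
unit balls of `ℝ^(p²)` and `ℝ^(q²)` (`l2_opNorm_le_of_nets`). By a volume argument the nets have
at most `(1 + 2/ε')^(p²)` and `(1 + 2/ε')^(q²)` points (`exists_net_unitBall`), and the union bound
over pairs of net points is absorbed by the exponent because `t ≥ 4 C₂ log (1 + 2/ε')`.
-/

namespace PermutedSCM

/-! ### The centred chi-square law -/

lemma exp_neg_add_sq_le {y : ℝ} (hy : |y| ≤ 1 / 2) : Real.exp (-(y + y ^ 2)) ≤ 1 - y := by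
  obtain ⟨h1, h2⟩ := abs_le.1 hy
  rcases le_total 0 y with h | h
  · have hq := Real.quadratic_le_exp_of_nonneg (show 0 ≤ y + y ^ 2 by positivity)
    rw [Real.exp_neg, inv_le_comm₀ (Real.exp_pos _) (by linarith)]
    refine le_trans ?_ hq
    rw [inv_le_iff_one_le_mul₀ (by linarith)]
    have : 0 ≤ y ^ 2 * (1 - 2 * y) := by
      apply mul_nonneg (sq_nonneg _); linarith
    have : 0 ≤ y ^ 2 * (y * (1 - 2 * y)) := by
      apply mul_nonneg (sq_nonneg _); apply mul_nonneg h; linarith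
    have : 0 ≤ y ^ 4 * (1 - 2 * y) := by
      apply mul_nonneg (by positivity); linarith
    nlinarith [sq_nonneg y, pow_nonneg h 3, pow_nonneg h 4]
  · have h3 : |(-(y + y ^ 2))| ≤ 1 := by rw [abs_le]; constructor <;> nlinarith
    have := (abs_le.1 (Real.abs_exp_sub_one_sub_id_le h3)).2
    nlinarith [mul_nonneg (sq_nonneg y) (show 0 ≤ -y * (2 + y) by nlinarith)]

lemma gaussianPDFReal_mul_exp_sq (c x : ℝ) :
    gaussianPDFReal 0 1 x * Real.exp (c * (x ^ 2 - 1)) =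
      (√(2 * Real.pi))⁻¹ * Real.exp (-c) * Real.exp (-(1 / 2 - c) * x ^ 2) := by
  simp only [gaussianPDFReal, NNReal.coe_one, mul_one, sub_zero, mul_assoc, ← Real.exp_add]
  congr 2
  ring

lemma integrable_exp_sq_gaussianReal {c : ℝ} (hc : c < 1 / 2) :
    Integrable (fun x => Real.exp (c * (x ^ 2 - 1))) (gaussianReal 0 1) := by
  rw [gaussianReal_of_var_ne_zero 0 one_ne_zero,
    integrable_withDensity_iff_integrable_smul' (by fun_prop)
      (ae_of_all _ fun x => by simp [gaussianPDF])]
  simp only [gaussianPDF, ENNReal.toReal_ofReal (gaussianPDFReal_nonneg _ _ _), smul_eq_mul,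
    gaussianPDFReal_mul_exp_sq]
  exact (integrable_exp_neg_mul_sq (by linarith)).const_mul _

/-- The centred chi-square law is sub-gamma: near zero its moment generating function is bounded
by a Gaussian one. -/
lemma integral_exp_sq_gaussianReal_le {c : ℝ} (hc : |c| ≤ 1 / 4) :
    ∫ x, Real.exp (c * (x ^ 2 - 1)) ∂gaussianReal 0 1 ≤ Real.exp (2 * c ^ 2) := by
  obtain ⟨h1, h2⟩ := abs_le.1 hc
  rw [integral_gaussianReal_eq_integral_smul one_ne_zero]
  simp only [smul_eq_mul, gaussianPDFReal_mul_exp_sq]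
  rw [integral_const_mul, integral_gaussian]
  have hpi := Real.pi_pos
  have hpos : 0 < 1 - 2 * c := by linarith
  have e : Real.pi / (1 / 2 - c) = 2 * Real.pi / (1 - 2 * c) := by field_simp
  have hs : 0 < √(2 * Real.pi) := by positivity
  rw [e, Real.sqrt_div (by positivity)]
  have key := exp_neg_add_sq_le (y := 2 * c) (by rw [abs_le]; constructor <;> linarith)
  have key2 : Real.exp (-(c + 2 * c ^ 2)) ≤ √(1 - 2 * c) := by
    refine Real.le_sqrt_of_sq_le (le_trans (le_of_eq ?_) key)
    rw [← Real.exp_nat_mul]; congr 1; push_cast; ring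
  have hs2 : 0 < √(1 - 2 * c) := Real.sqrt_pos.2 hpos
  calc (√(2 * Real.pi))⁻¹ * Real.exp (-c) * (√(2 * Real.pi) / √(1 - 2 * c))
      = Real.exp (-c) / √(1 - 2 * c) := by field_simp
    _ ≤ Real.exp (2 * c ^ 2) := by
      rw [div_le_iff₀ hs2]
      calc Real.exp (-c) = Real.exp (2 * c ^ 2) * Real.exp (-(c + 2 * c ^ 2)) := by
            rw [← Real.exp_add]; congr 1; ring
        _ ≤ _ := by gcongr

/-! ### Frobenius norms and Gaussian chaos of order two -/

section Chaos

variable {ι : Type*} [Fintype ι]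

/-- The squared Frobenius norm of a matrix. -/
def frobSq {κ : Type*} [Fintype κ] (A : Matrix ι κ ℝ) : ℝ := ∑ i, ∑ j, A i j ^ 2

lemma frobSq_nonneg {κ : Type*} [Fintype κ] (A : Matrix ι κ ℝ) : 0 ≤ frobSq A := by
  unfold frobSq; positivity

lemma frobSq_transpose {κ : Type*} [Fintype κ] (A : Matrix ι κ ℝ) : frobSq Aᵀ = frobSq A := by
  unfold frobSq
  rw [Finset.sum_comm]
  rfl

/-- Applied column by column, left multiplication by `A` stretches the columns of `B` by at most
the operator norm of `A`. -/
lemma frobSq_mul_le [DecidableEq ι] (A B : Matrix ι ι ℝ) :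
    frobSq (A * B) ≤ ‖A‖ ^ 2 * frobSq B := by
  rw [← frobSq_transpose, ← frobSq_transpose B]
  unfold frobSq
  rw [Finset.mul_sum]
  refine Finset.sum_le_sum fun j _ => ?_
  have h := Matrix.l2_opNorm_mulVec A (WithLp.toLp 2 (Bᵀ j))
  have h2 := pow_le_pow_left₀ (norm_nonneg _) h 2
  rw [mul_pow, EuclideanSpace.real_norm_sq_eq, EuclideanSpace.real_norm_sq_eq] at h2
  exact h2

variable [DecidableEq ι]

lemma sum_sq_eigenvalues {H : Matrix ι ι ℝ} (hH : H.IsHermitian) :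
    ∑ i, hH.eigenvalues i ^ 2 = frobSq H := by
  have h1 : (H * H).trace = frobSq H := by
    simp only [Matrix.trace, Matrix.diag, Matrix.mul_apply, frobSq]
    refine Finset.sum_congr rfl fun i _ => Finset.sum_congr rfl fun j _ => ?_
    have : H j i = H i j := by simpa using congrFun (congrFun hH i) j
    rw [this, sq]
  rw [← h1]
  conv_rhs => rw [hH.spectral_theorem, ← map_mul]
  rw [Unitary.conjStarAlgAut_apply, Matrix.trace_mul_comm, ← mul_assoc,
    Unitary.coe_star_mul_self, one_mul, Matrix.diagonal_mul_diagonal, Matrix.trace_diagonal]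
  simp [sq]

lemma inner_sum_eigenvectorBasis {H : Matrix ι ι ℝ} (hH : H.IsHermitian) (y : ι → ℝ) :
    (∑ i, y i • hH.eigenvectorBasis i).ofLp ⬝ᵥ H *ᵥ (∑ i, y i • hH.eigenvectorBasis i).ofLp =
      ∑ i, hH.eigenvalues i * y i ^ 2 := by
  have h1 : ∀ i, Matrix.toEuclideanCLM (𝕜 := ℝ) H (hH.eigenvectorBasis i) =
      hH.eigenvalues i • hH.eigenvectorBasis i := by
    intro i
    ext j
    simp [hH.mulVec_eigenvectorBasis]
  rw [← Matrix.inner_toEuclideanCLM, map_sum]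
  simp only [map_smul, h1, smul_smul]
  rw [hH.eigenvectorBasis.orthonormal.inner_sum]
  refine Finset.sum_congr rfl fun i _ => ?_
  simp
  ring

/-- Moment generating function bound for a centred Gaussian chaos of order two with symmetric
matrix: in an eigenbasis it is a sum of independent centred multiples of chi-square variables. -/
lemma exp_quadratic_stdGaussian_of_isHermitian {H : Matrix ι ι ℝ} (hH : H.IsHermitian)
    (hf : frobSq H ≤ 1 / 16) :
    Integrable (fun x => Real.exp (x.ofLp ⬝ᵥ H *ᵥ x.ofLp - H.trace))
        (stdGaussian (EuclideanSpace ℝ ι)) ∧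
      ∫ x, Real.exp (x.ofLp ⬝ᵥ H *ᵥ x.ofLp - H.trace) ∂stdGaussian (EuclideanSpace ℝ ι) ≤
        Real.exp (2 * frobSq H) := by
  have hd : ∀ i, |hH.eigenvalues i| ≤ 1 / 4 := by
    intro i
    have h1 : hH.eigenvalues i ^ 2 ≤ 1 / 16 :=
      (Finset.single_le_sum (f := fun i => hH.eigenvalues i ^ 2) (fun _ _ => sq_nonneg _)
        (Finset.mem_univ i)).trans ((sum_sq_eigenvalues hH).le.trans hf)
    apply abs_le_of_sq_le_sq _ (by norm_num)
    linarith
  have hprod : ∀ y : ι → ℝ, Real.exp ((∑ i, y i • hH.eigenvectorBasis i).ofLp ⬝ᵥ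
      H *ᵥ (∑ i, y i • hH.eigenvectorBasis i).ofLp - H.trace) =
        ∏ i, Real.exp (hH.eigenvalues i * (y i ^ 2 - 1)) := by
    intro y
    rw [inner_sum_eigenvectorBasis, hH.trace_eq_sum_eigenvalues, ← Real.exp_sum]
    congr 1
    simp only [mul_sub, mul_one, Finset.sum_sub_distrib, RCLike.ofReal_real_eq_id, id]
  have hcont : Continuous fun x : EuclideanSpace ℝ ι =>
      Real.exp (x.ofLp ⬝ᵥ H *ᵥ x.ofLp - H.trace) := by
    unfold Matrix.mulVec dotProduct
    fun_prop
  rw [stdGaussian_eq_map_pi_orthonormalBasis hH.eigenvectorBasis,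
    integrable_map_measure hcont.aestronglyMeasurable (Measurable.aemeasurable (by fun_prop)),
    integral_map (Measurable.aemeasurable (by fun_prop)) hcont.aestronglyMeasurable]
  simp only [Function.comp_def, hprod]
  constructor
  · exact Integrable.fintype_prod (f := fun i x => Real.exp (hH.eigenvalues i * (x ^ 2 - 1)))
      fun i => integrable_exp_sq_gaussianReal (by linarith [(abs_le.1 (hd i)).2])
  · rw [integral_fintype_prod_eq_prod
      (f := fun i x => Real.exp (hH.eigenvalues i * (x ^ 2 - 1))), ← sum_sq_eigenvalues hH,
      Finset.mul_sum, Real.exp_sum]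
    exact Finset.prod_le_prod (fun i _ => integral_nonneg fun x => (Real.exp_pos _).le)
      fun i _ => integral_exp_sq_gaussianReal_le (hd i)

/-- The quadratic form of a square matrix only depends on its symmetric part, and symmetrization
does not increase the Frobenius norm. -/
lemma exp_quadratic_stdGaussian (K : Matrix ι ι ℝ) (hf : frobSq K ≤ 1 / 16) :
    Integrable (fun x => Real.exp (x.ofLp ⬝ᵥ K *ᵥ x.ofLp - K.trace))
        (stdGaussian (EuclideanSpace ℝ ι)) ∧
      ∫ x, Real.exp (x.ofLp ⬝ᵥ K *ᵥ x.ofLp - K.trace) ∂stdGaussian (EuclideanSpace ℝ ι) ≤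
        Real.exp (2 * frobSq K) := by
  set H : Matrix ι ι ℝ := (1 / 2 : ℝ) • (K + Kᵀ) with hHdef
  have hH : H.IsHermitian := by
    rw [Matrix.IsHermitian, Matrix.conjTranspose_eq_transpose_of_trivial, hHdef,
      Matrix.transpose_smul, Matrix.transpose_add, Matrix.transpose_transpose, add_comm]
  have hquad : ∀ x : ι → ℝ, x ⬝ᵥ K *ᵥ x = x ⬝ᵥ H *ᵥ x := by
    intro x
    have : x ⬝ᵥ Kᵀ *ᵥ x = x ⬝ᵥ K *ᵥ x := by
      rw [Matrix.mulVec_transpose, dotProduct_comm, Matrix.dotProduct_mulVec]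
    rw [hHdef, Matrix.smul_mulVec, Matrix.add_mulVec, dotProduct_smul, dotProduct_add, this,
      smul_eq_mul]
    ring
  have htr : K.trace = H.trace := by
    rw [hHdef, Matrix.trace_smul, Matrix.trace_add, Matrix.trace_transpose, smul_eq_mul]
    ring
  have hfr : frobSq H ≤ frobSq K := by
    have h2 : frobSq K = ∑ i, ∑ j, (1 / 2 * K i j ^ 2 + 1 / 2 * Kᵀ i j ^ 2) := by
      simp only [Finset.sum_add_distrib, ← Finset.mul_sum]
      change frobSq K = 1 / 2 * frobSq K + 1 / 2 * frobSq Kᵀ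
      rw [frobSq_transpose]; ring
    rw [h2]
    refine Finset.sum_le_sum fun i _ => Finset.sum_le_sum fun j _ => ?_
    simp only [hHdef, Matrix.smul_apply, Matrix.add_apply, smul_eq_mul]
    nlinarith [sq_nonneg (K i j - Kᵀ i j)]
  simp only [hquad, htr]
  obtain ⟨h1, h2⟩ := exp_quadratic_stdGaussian_of_isHermitian hH (hfr.trans hf)
  exact ⟨h1, h2.trans (by gcongr)⟩

open scoped MatrixOrder in
/-- Moment generating function bound for a Gaussian chaos of order two with general covariance,
obtained by writing the Gaussian vector as `√S` applied to a standard one. -/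
lemma exp_quadratic_multivariateGaussian {S : Matrix ι ι ℝ} (hS : S.PosSemidef)
    (G : Matrix ι ι ℝ) (hG : ‖S‖ ^ 2 * frobSq G ≤ 1 / 16) :
    Integrable (fun x => Real.exp (x.ofLp ⬝ᵥ G *ᵥ x.ofLp - (G * S).trace))
        (multivariateGaussian 0 S) ∧
      ∫ x, Real.exp (x.ofLp ⬝ᵥ G *ᵥ x.ofLp - (G * S).trace) ∂multivariateGaussian 0 S ≤
        Real.exp (2 * (‖S‖ ^ 2 * frobSq G)) := by
  set R := CFC.sqrt S with hR
  have hRR : R * R = S := CFC.sqrt_mul_sqrt_self S hS.nonneg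
  have hRs : star R = R := (CFC.sqrt_nonneg S).isSelfAdjoint
  have hRt : Rᵀ = R := by
    rwa [Matrix.star_eq_conjTranspose, Matrix.conjTranspose_eq_transpose_of_trivial] at hRs
  have hnorm : ‖R‖ ^ 2 = ‖S‖ := by
    rw [← hRR, sq, ← CStarRing.norm_star_mul_self, hRs]
  have hK : frobSq (R * G * R) ≤ ‖S‖ ^ 2 * frobSq G := by
    calc frobSq (R * G * R) = frobSq (R * (G * R)) := by rw [mul_assoc]
      _ ≤ ‖R‖ ^ 2 * frobSq (G * R) := frobSq_mul_le _ _
      _ = ‖R‖ ^ 2 * frobSq (R * Gᵀ) := by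
        rw [← frobSq_transpose (G * R), Matrix.transpose_mul, hRt]
      _ ≤ ‖R‖ ^ 2 * (‖R‖ ^ 2 * frobSq Gᵀ) := by gcongr; exact frobSq_mul_le _ _
      _ = ‖S‖ ^ 2 * frobSq G := by rw [frobSq_transpose, hnorm]; ring
  have htr : (G * S).trace = (R * G * R).trace := by
    rw [← hRR, ← mul_assoc, Matrix.trace_mul_comm, mul_assoc]
  have hquad : ∀ x : EuclideanSpace ℝ ι,
      (0 + Matrix.toEuclideanCLM (𝕜 := ℝ) R x).ofLp ⬝ᵥ
        G *ᵥ (0 + Matrix.toEuclideanCLM (𝕜 := ℝ) R x).ofLp =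
      x.ofLp ⬝ᵥ (R * G * R) *ᵥ x.ofLp := by
    intro x
    rw [zero_add, Matrix.ofLp_toEuclideanCLM, ← Matrix.mulVec_mulVec, ← Matrix.mulVec_mulVec,
      Matrix.dotProduct_mulVec x.ofLp R, ← Matrix.mulVec_transpose, hRt]
  have hcont : Continuous fun x : EuclideanSpace ℝ ι =>
      Real.exp (x.ofLp ⬝ᵥ G *ᵥ x.ofLp - (G * S).trace) := by
    unfold Matrix.mulVec dotProduct
    fun_prop
  rw [multivariateGaussian, integrable_map_measure hcont.aestronglyMeasurable (by fun_prop),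
    integral_map (by fun_prop) hcont.aestronglyMeasurable]
  simp only [Function.comp_def, ← hR, hquad, htr]
  obtain ⟨h1, h2⟩ := exp_quadratic_stdGaussian (R * G * R) (hK.trans hG)
  exact ⟨h1, h2.trans (by gcongr)⟩

end Chaos

/-! ### Nets of unit balls and operator norms -/

section Nets

variable {E F : Type*} [NormedAddCommGroup E] [InnerProductSpace ℝ E]
  [NormedAddCommGroup F] [InnerProductSpace ℝ F]

/-- Volume bound for packings of the unit ball: the balls of radius `ε / 2` around the points
are disjoint and lie in the ball of radius `1 + ε / 2`. -/
lemma card_le_of_separated_unitBall [FiniteDimensional ℝ E] {ε : ℝ} (hε : 0 < ε) (s : Finset E)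
    (hs : ∀ c ∈ s, ‖c‖ ≤ 1) (h : ∀ c ∈ s, ∀ d ∈ s, c ≠ d → ε ≤ ‖c - d‖) :
    (s.card : ℝ) ≤ (1 + 2 / ε) ^ Module.finrank ℝ E := by
  borelize E
  let μ : Measure E := Measure.addHaar
  have hδ : 0 < ε / 2 := by positivity
  have hρ : 0 < 1 + ε / 2 := by positivity
  have hdisj : (s : Set E).PairwiseDisjoint fun c => Metric.ball c (ε / 2) := by
    intro c hc d hd hcd
    apply Metric.ball_disjoint_ball
    rw [dist_eq_norm, add_halves]
    exact h c hc d hd hcd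
  have hsub : (⋃ c ∈ s, Metric.ball c (ε / 2)) ⊆ Metric.ball (0 : E) (1 + ε / 2) := by
    refine Set.iUnion₂_subset fun x hx => Metric.ball_subset_ball' ?_
    rw [dist_zero_right]
    linarith [hs x hx]
  have hvol : (s.card : ENNReal) * ENNReal.ofReal ((ε / 2) ^ Module.finrank ℝ E) *
      μ (Metric.ball 0 1) ≤
        ENNReal.ofReal ((1 + ε / 2) ^ Module.finrank ℝ E) * μ (Metric.ball 0 1) := by
    calc _ = μ (⋃ c ∈ s, Metric.ball c (ε / 2)) := by
          rw [measure_biUnion_finset hdisj fun c _ => measurableSet_ball]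
          simp only [μ.addHaar_ball_of_pos _ hδ, Finset.sum_const, nsmul_eq_mul, mul_assoc]
      _ ≤ μ (Metric.ball (0 : E) (1 + ε / 2)) := measure_mono hsub
      _ = _ := by simp only [μ.addHaar_ball_of_pos _ hρ]
  have hcard := ENNReal.toReal_le_of_le_ofReal (pow_nonneg hρ.le _)
    ((ENNReal.mul_le_mul_iff_left (Metric.measure_ball_pos _ _ zero_lt_one).ne'
      measure_ball_lt_top.ne).1 hvol)
  rw [ENNReal.toReal_mul, ENNReal.toReal_natCast, ENNReal.toReal_ofReal (by positivity)] at hcard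
  rw [show 1 + 2 / ε = (1 + ε / 2) / (ε / 2) by field_simp; ring, div_pow,
    le_div_iff₀ (by positivity)]
  exact hcard

/-- A separated subset of the unit ball of maximal cardinality is a net. -/
lemma exists_net_unitBall (E : Type*) [NormedAddCommGroup E] [InnerProductSpace ℝ E]
    [FiniteDimensional ℝ E] {ε : ℝ} (hε : 0 < ε) :
    ∃ N : Finset E, (∀ x ∈ N, ‖x‖ ≤ 1) ∧ (∀ x : E, ‖x‖ ≤ 1 → ∃ y ∈ N, ‖x - y‖ ≤ ε) ∧
      (N.card : ℝ) ≤ (1 + 2 / ε) ^ Module.finrank ℝ E := by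
  classical
  let P : Finset E → Prop := fun s =>
    (∀ c ∈ s, ‖c‖ ≤ 1) ∧ ∀ c ∈ s, ∀ d ∈ s, c ≠ d → ε ≤ ‖c - d‖
  let K : Set ℕ := {k | ∃ s, P s ∧ s.card = k}
  have hbdd : BddAbove K := by
    refine ⟨⌊(1 + 2 / ε) ^ Module.finrank ℝ E⌋₊, ?_⟩
    rintro _ ⟨s, hs, rfl⟩
    exact Nat.le_floor (card_le_of_separated_unitBall hε s hs.1 hs.2)
  obtain ⟨N, hN, hcard⟩ : sSup K ∈ K := Nat.sSup_mem ⟨0, ∅, by simp [P], rfl⟩ hbdd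
  refine ⟨N, hN.1, fun x hx => ?_, card_le_of_separated_unitBall hε N hN.1 hN.2⟩
  by_contra! hfar
  have hxN : x ∉ N := fun h => by
    have := hfar x h
    rw [sub_self, norm_zero] at this
    exact absurd this hε.not_gt
  have hP : P (insert x N) := by
    refine ⟨by simpa [hx] using hN.1, fun c hc d hd hcd => ?_⟩
    rcases Finset.mem_insert.1 hc with hcx | hcN <;> rcases Finset.mem_insert.1 hd with hdx | hdN
    · exact absurd (hcx.trans hdx.symm) hcd
    · rw [hcx]; exact (hfar d hdN).le
    · rw [hdx, norm_sub_rev]; exact (hfar c hcN).le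
    · exact hN.2 c hcN d hdN hcd
  have := le_csSup hbdd (show (insert x N).card ∈ K from ⟨_, hP, rfl⟩)
  rw [Finset.card_insert_of_notMem hxN, ← hcard] at this
  omega

/-- An operator norm is controlled by the values of the bilinear form on nets of the two unit
balls. -/
lemma opNorm_le_of_nets (T : E →L[ℝ] F) {ε a : ℝ} (hε : ε < 1 / 2) (N₁ : Finset F)
    (N₂ : Finset E) (h₁ : ∀ x ∈ N₁, ‖x‖ ≤ 1)
    (hN₁ : ∀ x : F, ‖x‖ ≤ 1 → ∃ y ∈ N₁, ‖x - y‖ ≤ ε)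
    (hN₂ : ∀ x : E, ‖x‖ ≤ 1 → ∃ y ∈ N₂, ‖x - y‖ ≤ ε)
    (h : ∀ x ∈ N₁, ∀ y ∈ N₂, inner ℝ x (T y) ≤ a) : ‖T‖ ≤ a / (1 - 2 * ε) := by
  have hε0 : 0 ≤ ε := by
    obtain ⟨y, -, hy⟩ := hN₁ 0 (by simp)
    exact (norm_nonneg _).trans hy
  have key : ∀ (x : F) (y : E), ‖x‖ ≤ 1 → ‖y‖ ≤ 1 → inner ℝ x (T y) ≤ a + 2 * ε * ‖T‖ := by
    intro x y hx hy
    obtain ⟨x', hx', hxx⟩ := hN₁ x hx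
    obtain ⟨y', hy', hyy⟩ := hN₂ y hy
    have e : inner ℝ x (T y) =
        inner ℝ x' (T y') + inner ℝ (x - x') (T y) + inner ℝ x' (T (y - y')) := by
      rw [map_sub, inner_sub_left, inner_sub_right]; ring
    have b1 : inner ℝ (x - x') (T y) ≤ ε * ‖T‖ :=
      (real_inner_le_norm _ _).trans (mul_le_mul hxx (T.unit_le_opNorm y hy) (norm_nonneg _) hε0)
    have b2 : inner ℝ x' (T (y - y')) ≤ ε * ‖T‖ := by
      refine (real_inner_le_norm _ _).trans ?_
      calc ‖x'‖ * ‖T (y - y')‖ ≤ 1 * (‖T‖ * ε) := by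
            gcongr
            · exact h₁ x' hx'
            · exact (T.le_opNorm _).trans (by gcongr)
        _ = ε * ‖T‖ := by ring
    linarith [h x' hx' y' hy']
  have hnn : 0 ≤ a + 2 * ε * ‖T‖ := by simpa using key 0 0 (by simp) (by simp)
  have hT : ‖T‖ ≤ a + 2 * ε * ‖T‖ := by
    refine T.opNorm_le_of_unit_norm hnn fun y hy => ?_
    rcases eq_or_ne (T y) 0 with h0 | h0
    · rwa [h0, norm_zero]
    · have := key (‖T y‖⁻¹ • T y) y (by rw [norm_smul, norm_inv, norm_norm,
        inv_mul_cancel₀ (norm_ne_zero_iff.2 h0)]) hy.le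
      rwa [real_inner_smul_left, real_inner_self_eq_norm_sq, sq, ← mul_assoc,
        inv_mul_cancel₀ (norm_ne_zero_iff.2 h0), one_mul] at this
  rw [le_div_iff₀ (by linarith)]
  linarith

lemma l2_opNorm_le_of_nets {m n : Type*} [Fintype m] [Fintype n] [DecidableEq n]
    (A : Matrix m n ℝ) {ε a : ℝ} (hε : ε < 1 / 2) (N₁ : Finset (EuclideanSpace ℝ m))
    (N₂ : Finset (EuclideanSpace ℝ n)) (h₁ : ∀ x ∈ N₁, ‖x‖ ≤ 1)
    (hN₁ : ∀ x : EuclideanSpace ℝ m, ‖x‖ ≤ 1 → ∃ y ∈ N₁, ‖x - y‖ ≤ ε)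
    (hN₂ : ∀ x : EuclideanSpace ℝ n, ‖x‖ ≤ 1 → ∃ y ∈ N₂, ‖x - y‖ ≤ ε)
    (h : ∀ x ∈ N₁, ∀ y ∈ N₂, x.ofLp ⬝ᵥ A *ᵥ y.ofLp ≤ a) : ‖A‖ ≤ a / (1 - 2 * ε) := by
  rw [Matrix.l2_opNorm_def]
  refine opNorm_le_of_nets _ hε N₁ N₂ h₁ hN₁ hN₂ fun x hx y hy =>
    le_trans (le_of_eq ?_) (h x hx y hy)
  rw [EuclideanSpace.inner_eq_star_dotProduct, dotProduct_comm]
  rfl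

end Nets

/-! ### Concentration of sums of Gaussian chaoses -/

section Concentration

variable {Ω : Type*} [MeasurableSpace Ω] {P : Measure Ω} [IsProbabilityMeasure P]
  {ι : Type*} [Fintype ι] [DecidableEq ι]

/-- Chernoff bound for a sum of independent Gaussian chaoses of order two. -/
lemma measureReal_sum_quadratic_ge_le {n : ℕ} {S : Matrix ι ι ℝ} (hS : S.PosSemidef)
    {z : Fin n → Ω → EuclideanSpace ℝ ι} (hlaw : ∀ s, HasLaw (z s) (multivariateGaussian 0 S) P)
    (hindep : iIndepFun z P) (G : Matrix ι ι ℝ) {l : ℝ} (hl : 0 ≤ l)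
    (hG : (l * ‖S‖) ^ 2 * frobSq G ≤ 1 / 16) (v : ℝ) :
    P.real {ω | v ≤ ∑ s, ((z s ω).ofLp ⬝ᵥ G *ᵥ (z s ω).ofLp - (G * S).trace)} ≤
      Real.exp (-l * v + n * (2 * ((l * ‖S‖) ^ 2 * frobSq G))) := by
  let g : EuclideanSpace ℝ ι → ℝ := fun x => x.ofLp ⬝ᵥ G *ᵥ x.ofLp - (G * S).trace
  have hg : Continuous g := by
    simp only [g, Matrix.mulVec, dotProduct]
    fun_prop
  let X : Fin n → Ω → ℝ := fun s => g ∘ z s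
  have hX : ∀ s, AEMeasurable (X s) P := fun s =>
    hg.measurable.comp_aemeasurable (hlaw s).aemeasurable
  have hXind : iIndepFun X P := hindep.comp (fun _ => g) fun _ => hg.measurable
  have hfrob : frobSq (l • G) = l ^ 2 * frobSq G := by
    simp only [frobSq, Matrix.smul_apply, smul_eq_mul, mul_pow, Finset.mul_sum]
  have hscale : ‖S‖ ^ 2 * frobSq (l • G) = (l * ‖S‖) ^ 2 * frobSq G := by rw [hfrob]; ring
  have hgl : ∀ x : EuclideanSpace ℝ ι,
      x.ofLp ⬝ᵥ (l • G) *ᵥ x.ofLp - ((l • G) * S).trace = l * g x := by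
    intro x
    simp only [g, Matrix.smul_mulVec, dotProduct_smul, smul_mul_assoc, Matrix.trace_smul,
      smul_eq_mul]
    ring
  obtain ⟨hint, hle⟩ := exp_quadratic_multivariateGaussian hS (l • G) (hscale.trans_le hG)
  simp only [hgl, hscale] at hint hle
  have hmgf : ∀ s, mgf (X s) P l = ∫ x, Real.exp (l * g x) ∂multivariateGaussian 0 S := fun s =>
    (hlaw s).integral_comp (f := fun x => Real.exp (l * g x))
      (by fun_prop : Continuous fun x => Real.exp (l * g x)).aestronglyMeasurable
  have hpos : 0 < ∫ x, Real.exp (l * g x) ∂multivariateGaussian 0 S := integral_exp_pos hint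
  have hsum := hXind.mgf_sum₀ hX (t := l) Finset.univ
  simp only [hmgf, Finset.prod_const, Finset.card_univ, Fintype.card_fin] at hsum
  have hsumint : Integrable (fun ω => Real.exp (l * (∑ s, X s) ω)) P := by
    -- An mgf is positive exactly when the exponential is integrable.
    rw [← mgf_pos_iff, hsum]
    positivity
  have hch := measure_ge_le_exp_mul_mgf v hl hsumint
  rw [hsum] at hch
  simp only [Finset.sum_apply] at hch
  refine hch.trans ?_
  rw [Real.exp_add, Real.exp_nat_mul]
  gcongr

end Concentration

/-! ### Bilinear forms of the rearranged error -/

section Rearrangement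

variable {p q n : ℕ}

/-- The coefficient matrix `G` with `x ⬝ᵥ rearrange A *ᵥ y = ∑ a b, G a b * A a b`. It is the
Kronecker product `X ⊗ Y` of the matrices with `X i j = x (i, j)` and `Y k l = y (l, k)`; the
second pair is swapped because `Matrix.vec` stacks columns. -/
def coeffMatrix (x : EuclideanSpace ℝ (Fin p × Fin p)) (y : EuclideanSpace ℝ (Fin q × Fin q)) :
    Matrix (Fin p × Fin q) (Fin p × Fin q) ℝ :=
  Matrix.of fun a b => x (a.1, b.1) * y (b.2, a.2)

lemma frobSq_coeffMatrix (x : EuclideanSpace ℝ (Fin p × Fin p))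
    (y : EuclideanSpace ℝ (Fin q × Fin q)) :
    frobSq (coeffMatrix x y) = ‖x‖ ^ 2 * ‖y‖ ^ 2 := by
  rw [EuclideanSpace.real_norm_sq_eq, EuclideanSpace.real_norm_sq_eq, Finset.sum_mul_sum]
  simp only [frobSq, coeffMatrix, Matrix.of_apply, Fintype.sum_prod_type, mul_pow]
  refine Finset.sum_congr rfl fun i _ => ?_
  rw [Finset.sum_comm]
  refine Finset.sum_congr rfl fun j _ => ?_
  rw [Finset.sum_comm]

lemma dotProduct_rearrange_mulVec (A : Matrix (Fin p × Fin q) (Fin p × Fin q) ℝ)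
    (x : EuclideanSpace ℝ (Fin p × Fin p)) (y : EuclideanSpace ℝ (Fin q × Fin q)) :
    x.ofLp ⬝ᵥ rearrange A *ᵥ y.ofLp = (coeffMatrix x y * Aᵀ).trace := by
  simp only [dotProduct, Matrix.mulVec, rearrange, block, Matrix.vec, Matrix.of_apply,
    Matrix.trace, Matrix.diag, Matrix.mul_apply, coeffMatrix, Fintype.sum_prod_type,
    Matrix.transpose_apply, Finset.mul_sum]
  refine Finset.sum_congr rfl fun i _ => ?_
  conv_rhs => rw [Finset.sum_comm]
  refine Finset.sum_congr rfl fun j _ => ?_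
  conv_rhs => rw [Finset.sum_comm]
  refine Finset.sum_congr rfl fun l _ => Finset.sum_congr rfl fun k _ => ?_
  ring

lemma trace_mul_vecMulVec {ι : Type*} [Fintype ι] (G : Matrix ι ι ℝ) (v : ι → ℝ) :
    (G * Matrix.vecMulVec v v).trace = v ⬝ᵥ G *ᵥ v := by
  rw [Matrix.mul_vecMulVec, Matrix.trace_vecMulVec, dotProduct_comm]

/-- A bilinear form of the error matrix is an average of independent centred Gaussian chaoses of
order two, all with the same coefficient matrix. -/
lemma natCast_mul_dotProduct_errorMatrix_mulVec (hn : 0 < n)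
    {S₀ : Matrix (Fin p × Fin q) (Fin p × Fin q) ℝ} (hS₀ : S₀.PosSemidef)
    (z : Fin n → EuclideanSpace ℝ (Fin p × Fin q))
    (x : EuclideanSpace ℝ (Fin p × Fin p)) (y : EuclideanSpace ℝ (Fin q × Fin q)) :
    n * (x.ofLp ⬝ᵥ errorMatrix S₀ z *ᵥ y.ofLp) =
      ∑ s, ((z s).ofLp ⬝ᵥ coeffMatrix x y *ᵥ (z s).ofLp - (coeffMatrix x y * S₀).trace) := by
  have hn' : (n : ℝ) ≠ 0 := by positivity
  have hSt : S₀ᵀ = S₀ := by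
    have := hS₀.isHermitian
    rwa [Matrix.IsHermitian, Matrix.conjTranspose_eq_transpose_of_trivial] at this
  rw [errorMatrix, dotProduct_rearrange_mulVec, Matrix.transpose_sub, hSt, sampleCov,
    Matrix.transpose_smul, Matrix.transpose_sum]
  simp only [Matrix.transpose_vecMulVec]
  rw [mul_sub, Matrix.trace_sub, mul_smul_comm, Matrix.trace_smul, Matrix.mul_sum,
    Matrix.trace_sum]
  simp only [trace_mul_vecMulVec]
  rw [Finset.sum_sub_distrib, Finset.sum_const, Finset.card_univ, Fintype.card_fin, smul_eq_mul,
    nsmul_eq_mul]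
  field_simp

end Rearrangement

/-! ### Tail bound for the error matrix -/

lemma two_le_C₂ : 2 ≤ C₂ := by
  have h1 := Real.exp_one_gt_d9
  have h2 : 1 ≤ √(2 : ℝ) := Real.one_le_sqrt.2 (by norm_num)
  unfold C₂
  nlinarith

lemma one_le_log_one_add_two_div {ε : ℝ} (hε₀ : 0 < ε) (hε : ε < 1 / 2) :
    1 ≤ Real.log (1 + 2 / ε) := by
  have h : 4 ≤ 2 / ε := by rw [le_div_iff₀ hε₀]; linarith
  rw [Real.le_log_iff_exp_le (by linarith)]
  linarith [Real.exp_one_lt_d9]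

lemma errorMatrix_eq_zero_of_cov_eq_zero {p q n : ℕ} (z : Fin n → EuclideanSpace ℝ (Fin p × Fin q))
    (hz : ∀ s, z s = 0) : errorMatrix 0 z = 0 := by
  have : sampleCov z = 0 := by simp [sampleCov, hz]
  rw [errorMatrix, this, sub_zero]
  rfl

lemma multivariateGaussian_zero_cov {ι : Type*} [Fintype ι] [DecidableEq ι] :
    multivariateGaussian 0 (0 : Matrix ι ι ℝ) = Measure.dirac 0 := by
  simp [multivariateGaussian]

/-- The tail of one bilinear form of the error matrix at the deviation level
`‖S₀‖ t max(β, √β)`, from the Chernoff parameter `m / (4 ‖S₀‖)` with `m = min(1, √β)`. This choice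
treats the sub-Gaussian range `β ≤ 1` and the sub-exponential range `β ≥ 1` together: the linear
term of the exponent contains `m max(β, √β) = β`, the quadratic one `m² ≤ β`. -/
lemma measureReal_lt_dotProduct_errorMatrix_le {Ω : Type*} [MeasurableSpace Ω] {P : Measure Ω}
    [IsProbabilityMeasure P] {p q n : ℕ} (hn : 0 < n)
    {S₀ : Matrix (Fin p × Fin q) (Fin p × Fin q) ℝ} (hS₀ : S₀.PosSemidef) (hpos : 0 < ‖S₀‖)
    {z : Fin n → Ω → EuclideanSpace ℝ (Fin p × Fin q)}
    (hlaw : ∀ s, HasLaw (z s) (multivariateGaussian 0 S₀) P) (hindep : iIndepFun z P)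
    (t : ℝ) {β : ℝ} (hβ : 0 ≤ β)
    {x : EuclideanSpace ℝ (Fin p × Fin p)} {y : EuclideanSpace ℝ (Fin q × Fin q)}
    (hx : ‖x‖ ≤ 1) (hy : ‖y‖ ≤ 1) :
    P.real {ω | ‖S₀‖ * t * max β √β <
        x.ofLp ⬝ᵥ errorMatrix S₀ (fun s => z s ω) *ᵥ y.ofLp} ≤
      Real.exp (-(n * β) * (t / 4 - 1 / 8)) := by
  have hn' : (0 : ℝ) < n := by positivity
  set m := min 1 √β with hm
  have hm0 : 0 ≤ m := le_min zero_le_one (Real.sqrt_nonneg _)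
  have hmax : m * max β √β = β := by
    rcases le_total 1 (√β) with h | h
    · have : √β ≤ β := by nlinarith [Real.sq_sqrt hβ]
      rw [hm, min_eq_left h, max_eq_left this, one_mul]
    · have : β ≤ √β := by nlinarith [Real.sq_sqrt hβ, Real.sqrt_nonneg β]
      rw [hm, min_eq_right h, max_eq_right this, Real.mul_self_sqrt hβ]
  have hm1 : m ^ 2 ≤ 1 := pow_le_one₀ hm0 (min_le_left _ _)
  have hmβ : m ^ 2 ≤ β := by
    rw [← Real.sq_sqrt hβ]
    exact pow_le_pow_left₀ hm0 (min_le_right _ _) 2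
  have hfrob : frobSq (coeffMatrix x y) ≤ 1 := by
    rw [frobSq_coeffMatrix]
    exact mul_le_one₀ (pow_le_one₀ (norm_nonneg _) hx) (by positivity)
      (pow_le_one₀ (norm_nonneg _) hy)
  have hlS : m / (4 * ‖S₀‖) * ‖S₀‖ = m / 4 := by field_simp
  have hbound : (m / (4 * ‖S₀‖) * ‖S₀‖) ^ 2 * frobSq (coeffMatrix x y) ≤ m ^ 2 / 16 := by
    rw [hlS, div_pow]
    have := mul_le_of_le_one_right (show 0 ≤ m ^ 2 / 4 ^ 2 by positivity) hfrob
    linarith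
  have htail := measureReal_sum_quadratic_ge_le hS₀ hlaw hindep (coeffMatrix x y)
    (l := m / (4 * ‖S₀‖)) (by positivity) (hbound.trans (by linarith))
    (n * (‖S₀‖ * t * max β √β))
  refine (measureReal_mono ?_ (measure_ne_top _ _)).trans (htail.trans ?_)
  · intro ω hω
    rw [Set.mem_ofPred_eq, ← natCast_mul_dotProduct_errorMatrix_mulVec hn hS₀]
    exact mul_le_mul_of_nonneg_left (le_of_lt hω) hn'.le
  · apply Real.exp_le_exp.2
    have e : -(m / (4 * ‖S₀‖)) * (n * (‖S₀‖ * t * max β √β)) = -(n * β) * (t / 4) := by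
      conv_rhs => rw [← hmax]
      field_simp
    rw [e]
    nlinarith [mul_le_mul_of_nonneg_left (hbound.trans (div_le_div_of_nonneg_right hmβ
      (by norm_num : (0 : ℝ) ≤ 16))) hn'.le]

end PermutedSCM

open PermutedSCM in
theorem theorem3 {Ω : Type*} [MeasurableSpace Ω] (P : Measure Ω) [IsProbabilityMeasure P]
    (p q n : ℕ) (hp : 0 < p) (hq : 0 < q) (hn : 0 < n)
    (S₀ : Matrix (Fin p × Fin q) (Fin p × Fin q) ℝ) (hS₀ : S₀.PosSemidef)
    (z : Fin n → Ω → EuclideanSpace ℝ (Fin p × Fin q))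
    (hlaw : ∀ s, HasLaw (z s) (multivariateGaussian 0 S₀) P)
    (hindep : iIndepFun z P)
    (M : ℕ) (hM : M = max (max p q) n)
    (ε' : ℝ) (hε₀ : 0 < ε') (hε : ε' < 1 / 2)
    (t : ℝ)
    (ht : max √(4 * PermutedSCM.C₁ * Real.log (1 + 2 / ε'))
      (4 * PermutedSCM.C₂ * Real.log (1 + 2 / ε')) ≤ t)
    (C : ℝ) (hC : C = max PermutedSCM.C₁ PermutedSCM.C₂) :
    1 - 2 * (M : ℝ) ^ (-(t / (4 * C))) ≤
      P.real {ω | ‖PermutedSCM.errorMatrix S₀ (fun s => z s ω)‖ ≤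
        ‖S₀‖ * t / (1 - 2 * ε') *
          max (((p : ℝ) ^ 2 + (q : ℝ) ^ 2 + Real.log M) / n)
            √(((p : ℝ) ^ 2 + (q : ℝ) ^ 2 + Real.log M) / n)} := by
  have hn' : (0 : ℝ) < n := by positivity
  have hMpos : (0 : ℝ) < M := by
    rw [hM]; exact_mod_cast hn.trans_le (le_max_right _ _)
  have hL : 0 ≤ Real.log M := Real.log_natCast_nonneg M
  set L := Real.log M with hLdef
  set β := ((p : ℝ) ^ 2 + (q : ℝ) ^ 2 + L) / n with hβdef
  have hβ : 0 ≤ β := by positivity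
  have hnβ : n * β = (p : ℝ) ^ 2 + (q : ℝ) ^ 2 + L := by rw [hβdef]; field_simp
  set B := {ω | ‖errorMatrix S₀ (fun s => z s ω)‖ ≤ ‖S₀‖ * t / (1 - 2 * ε') * max β √β} with hB
  -- For `S₀ = 0` the bound is zero and the Chernoff parameter below is undefined, but then every
  -- `z s` vanishes almost surely.
  rcases eq_or_ne S₀ 0 with h0 | h0
  · subst h0
    have hae : ∀ᵐ ω ∂P, ω ∈ B := by
      have : ∀ s, ∀ᵐ ω ∂P, z s ω = 0 := by
        intro s
        have h1 : ∀ᵐ x ∂(multivariateGaussian 0 (0 : Matrix (Fin p × Fin q) (Fin p × Fin q) ℝ)),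
            x = 0 := by
          rw [multivariateGaussian_zero_cov, ae_dirac_eq]; rfl
        rw [← (hlaw s).map_eq] at h1
        exact ae_of_ae_map (hlaw s).aemeasurable h1
      filter_upwards [ae_all_iff.2 this] with ω hω
      rw [hB, Set.mem_ofPred_eq, errorMatrix_eq_zero_of_cov_eq_zero _ hω]
      simp
    have h1 : P.real B = 1 := by
      have hB1 : B =ᵐ[P] Set.univ := Filter.eventuallyEq_univ.2 hae
      rw [measureReal_congr hB1, probReal_univ]
    rw [h1]
    have : 0 ≤ (M : ℝ) ^ (-(t / (4 * C))) := by positivity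
    linarith
  have hpos : 0 < ‖S₀‖ := norm_pos_iff.2 h0
  obtain ⟨N₁, hN₁le, hN₁, hN₁card⟩ := exists_net_unitBall (EuclideanSpace ℝ (Fin p × Fin p)) hε₀
  obtain ⟨N₂, hN₂le, hN₂, hN₂card⟩ := exists_net_unitBall (EuclideanSpace ℝ (Fin q × Fin q)) hε₀
  have hsub : Bᶜ ⊆ ⋃ xy ∈ N₁ ×ˢ N₂, {ω | ‖S₀‖ * t * max β √β <
      xy.1.ofLp ⬝ᵥ errorMatrix S₀ (fun s => z s ω) *ᵥ xy.2.ofLp} := by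
    intro ω hω
    by_contra hcon
    simp only [Set.mem_iUnion, Finset.mem_product, Set.mem_ofPred_eq, not_exists, not_lt,
      Prod.forall] at hcon
    refine hω ((l2_opNorm_le_of_nets _ hε N₁ N₂ hN₁le hN₁ hN₂
      fun x hx y hy => hcon x y ⟨hx, hy⟩).trans (le_of_eq ?_))
    ring
  set T := Real.log (1 + 2 / ε') with hT
  have hbase : 0 < 1 + 2 / ε' := by positivity
  have hbad : P.real Bᶜ ≤ Real.exp (T * ((p : ℝ) ^ 2 + (q : ℝ) ^ 2)) *
      Real.exp (-(n * β) * (t / 4 - 1 / 8)) := by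
    refine (measureReal_mono hsub (measure_ne_top _ _)).trans ?_
    refine (measureReal_biUnion_finset_le _ _).trans ?_
    refine (Finset.sum_le_sum fun xy hxy => measureReal_lt_dotProduct_errorMatrix_le hn hS₀ hpos
      hlaw hindep t hβ (hN₁le _ (Finset.mem_product.1 hxy).1)
      (hN₂le _ (Finset.mem_product.1 hxy).2)).trans ?_
    rw [Finset.sum_const, Finset.card_product, nsmul_eq_mul, Nat.cast_mul]
    gcongr
    have : Real.exp (T * ((p : ℝ) ^ 2 + (q : ℝ) ^ 2)) =
        (1 + 2 / ε') ^ (p * p) * (1 + 2 / ε') ^ (q * q) := by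
      rw [← pow_add, ← Real.exp_log hbase, ← Real.exp_nat_mul, ← hT]
      push_cast
      ring_nf
    rw [this]
    simp only [finrank_euclideanSpace, Fintype.card_prod, Fintype.card_fin] at hN₁card hN₂card
    gcongr
  -- Since `C ≥ C₂ ≥ 2` and `t ≥ 1`, the exponent rate `t / 4 - 1 / 8` dominates both the entropy
  -- `T ≤ t / (4 C₂)` of the nets and the rate `t / (4 C)` wanted for `log M`.
  have hC2 := two_le_C₂
  have hT1 : 1 ≤ T := one_le_log_one_add_two_div hε₀ hε
  have ht2 : 4 * C₂ * T ≤ t := (le_max_right _ _).trans ht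
  have hCC : C₂ ≤ C := hC ▸ le_max_right _ _
  have ht1 : 1 ≤ t := by nlinarith
  have hτ : t / (4 * C₂) ≤ t / 4 - 1 / 8 := by
    have : t / (4 * C₂) ≤ t / (4 * 2) := by gcongr
    linarith
  have hTτ : T ≤ t / 4 - 1 / 8 := by
    refine le_trans ?_ hτ
    rw [le_div_iff₀ (by linarith)]
    linarith
  have hCτ : t / (4 * C) ≤ t / 4 - 1 / 8 := by
    refine le_trans ?_ hτ
    gcongr
  have hM2 : (M : ℝ) ^ (-(t / (4 * C))) = Real.exp (-(L * (t / (4 * C)))) := by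
    rw [Real.rpow_def_of_pos hMpos, ← hLdef]; ring_nf
  have hbad2 : P.real Bᶜ ≤ (M : ℝ) ^ (-(t / (4 * C))) := by
    refine hbad.trans ?_
    rw [hM2, ← Real.exp_add, hnβ]
    apply Real.exp_le_exp.2
    have a1 := mul_le_mul_of_nonneg_right hTτ (show 0 ≤ (p : ℝ) ^ 2 + (q : ℝ) ^ 2 by positivity)
    have a2 := mul_le_mul_of_nonneg_left hCτ hL
    linarith
  -- Subadditivity, so that measurability of `B` is not needed.
  have hone : 1 ≤ P.real B + P.real Bᶜ := by
    have := measureReal_union_le (μ := P) B Bᶜ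
    rwa [Set.union_compl_self, probReal_univ] at this
  have : 0 ≤ (M : ℝ) ^ (-(t / (4 * C))) := by positivity
  linarith
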